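/- Let $m$ be a positive integer such that $q=2m^2+2m+1$ is a prime power, and put $n=4(m^2+m+1)=2q+2$. A Hadamard matrix of order $n$ is an $n\times n$ matrix $H$ with entries $\pm1$ and $HH^{\top}=H^{\top}H=nI_n$. It is called biregular if its row sums take exactly two values, both nonnegative integers. The excess of $H$ is the sum of all its entries. For an integer $n\ge 4$, let $k$ be the even integer with $k\le\sqrt n<k+2$, let $t=k$ if $|n-k^2|<|n-(k+2)^2|$ and $t=k-2$ otherwise, let $s=\lfloor n((t+4)^2-n)/(8t+16)\rfloor$, and define $\beta(n)=n(t+4)-4s$ (the Hammer–Levingston–Seberry bound). Let $\mathbb F_q$ be the finite field of order $q$, and let $M$ be the $q\times q$ matrix with rows and columns indexed by $\mathbb F_q$ whose $(i,j)$ entry is $0$ if $j=i$, $1$ if $j-i$ is a nonzero square, and $-1$ if $j-i$ is a nonsquare. Put $M_1=M+I_q$, $M_2=M-I_q$, $M_3=-M_1$, write $\mathbf 1_q$ for the all-one column vector of length $q$, and let $$P=\begin{pmatrix}1&-1&\mathbf 1_q^{\top}&\mathbf 1_q^{\top}\\-1&-1&\mathbf 1_q^{\top}&-\mathbf 1_q^{\top}\\\mathbf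 1_q&\mathbf 1_q&M_1&M_2\\\mathbf 1_q&-\mathbf 1_q&M_2&M_3\end{pmatrix}$$ be the Paley type-II matrix of order $2q+2=n$. Then there exists a biregular Hadamard matrix $H'$ of order $n=4(m^2+m+1)$ whose excess is maximum among all Hadamard matrices of order $n$ and is equal to $\beta(n)$. More precisely, such a matrix $H'$ can be obtained from $P$ by negating some rows and some columns, and it can be chosen so that the set of its row sums is exactly $\{2m-2,\,2m+2\}$ if $m$ is odd and exactly $\{2m,\,2m+4\}$ if $m$ is even. -/

import Mathlib

open Matrix

/-- Over `ℤ`, Mathlib's `Matrix.IsHadamard` says that the entries are `1` and `-1` and that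
`H Hᵀ = Hᵀ H = n I`, where `n` is the order. -/
theorem isHadamard_int_iff {ι : Type*} [Fintype ι] [DecidableEq ι] (H : Matrix ι ι ℤ) :
    H.IsHadamard ↔ (∀ i j, H i j = 1 ∨ H i j = -1) ∧
      H * Hᵀ = (Fintype.card ι : ℤ) • (1 : Matrix ι ι ℤ) ∧
      Hᵀ * H = (Fintype.card ι : ℤ) • (1 : Matrix ι ι ℤ) := by
  rw [Matrix.isHadamard_iff]
  simp only [conjTranspose_eq_transpose_of_trivial, Unitary.mem_iff, star_trivial, and_self,
    mul_self_eq_one_iff]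

/-- The vector `H 𝟏` of row sums. -/
def rowSum {ι : Type*} [Fintype ι] (H : Matrix ι ι ℤ) (i : ι) : ℤ := ∑ j, H i j

/-- A biregular Hadamard matrix: the row sums take exactly two values, both of them nonnegative
integers. -/
structure IsBiregularHadamard {ι : Type*} [Fintype ι] [DecidableEq ι] (H : Matrix ι ι ℤ) :
    Prop where
  isHadamard : H.IsHadamard
  two_values : ∃ k₁ k₂ : ℕ, k₁ ≠ k₂ ∧ Set.range (rowSum H) = {(k₁ : ℤ), (k₂ : ℤ)}

/-- The excess of a matrix: the sum of all its entries. -/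
def excess {ι : Type*} [Fintype ι] (H : Matrix ι ι ℤ) : ℤ := ∑ i, ∑ j, H i j

/-- `H` has the largest excess among all Hadamard matrices of the same order. -/
def HasMaximumExcess {ι : Type*} [Fintype ι] [DecidableEq ι] (H : Matrix ι ι ℤ) : Prop :=
  ∀ K : Matrix ι ι ℤ, K.IsHadamard → excess K ≤ excess H

/-- The even integer `k` with `k ≤ √n < k + 2`. -/
def hlsK (n : ℕ) : ℤ := ((2 * (Nat.sqrt n / 2) : ℕ) : ℤ)

theorem hlsK_spec (n : ℕ) :
    Even (hlsK n) ∧ (hlsK n : ℝ) ≤ Real.sqrt n ∧ Real.sqrt n < (hlsK n : ℝ) + 2 := by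
  have h1 : 2 * (Nat.sqrt n / 2) ≤ Nat.sqrt n := Nat.mul_div_le _ _
  have h2 : Nat.sqrt n + 1 ≤ 2 * (Nat.sqrt n / 2) + 2 := by omega
  refine ⟨by simp [hlsK], ?_, ?_⟩
  · have h : ((2 * (Nat.sqrt n / 2) : ℕ) : ℝ) ≤ (Nat.sqrt n : ℝ) := by exact_mod_cast h1
    have h3 := h.trans Real.nat_sqrt_le_real_sqrt
    have h4 : (hlsK n : ℝ) = ((2 * (Nat.sqrt n / 2) : ℕ) : ℝ) := by
      simp only [hlsK, Int.cast_natCast]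
    rwa [h4]
  · have h : ((Nat.sqrt n : ℝ) + 1) ≤ ((2 * (Nat.sqrt n / 2) : ℕ) : ℝ) + 2 := by
      exact_mod_cast h2
    have h3 := (Real.real_sqrt_lt_nat_sqrt_succ (a := n)).trans_le h
    have h4 : (hlsK n : ℝ) = ((2 * (Nat.sqrt n / 2) : ℕ) : ℝ) := by
      simp only [hlsK, Int.cast_natCast]
    rwa [h4]

/-- `t = k` if `|n - k²| < |n - (k+2)²|`, and `t = k - 2` otherwise. -/
def hlsT (n : ℕ) : ℤ :=
  if |(n : ℤ) - hlsK n ^ 2| < |(n : ℤ) - (hlsK n + 2) ^ 2| then hlsK n else hlsK n - 2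

/-- The upper bound of Hammer, Levingston and Seberry for the excess of a Hadamard matrix of order
`n`, namely `n(t+4) - 4s`, where `s` is the integer part of `n((t+4)² - n)/(8t+16)`. -/
def hlsBound (n : ℕ) : ℤ :=
  n * (hlsT n + 4) - 4 * ⌊((n * ((hlsT n + 4) ^ 2 - n) : ℤ) : ℚ) / ((8 * hlsT n + 16 : ℤ) : ℚ)⌋

/-- The all-one matrix. -/
def allOnes (α β : Type*) : Matrix α β ℤ := Matrix.of fun _ _ => 1

section Paley

variable (F : Type*) [Field F] [Fintype F] [DecidableEq F]

/-- The matrix `M` whose `(i, j)` entry is `0` if `j - i = 0`, `1` if `j - i` is a nonzero square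
and `-1` if `j - i` is a nonsquare. -/
def paleyCore : Matrix F F ℤ := Matrix.of fun i j => quadraticChar F (j - i)

/-- The Paley type-II matrix of order `2q + 2`, where `q = |F|`. With `M₁ = M + I`, `M₂ = M - I`
and `M₃ = -M₁` it has the rows of blocks `(1, -1, 𝟏ᵀ, 𝟏ᵀ)`, `(-1, -1, 𝟏ᵀ, -𝟏ᵀ)`,
`(𝟏, 𝟏, M₁, M₂)`, `(𝟏, -𝟏, M₂, M₃)`. -/
def paleyII : Matrix ((Unit ⊕ Unit) ⊕ (F ⊕ F)) ((Unit ⊕ Unit) ⊕ (F ⊕ F)) ℤ :=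
  fromBlocks
    (fromBlocks 1 (-1)
      (-1) (-1))
    (fromBlocks (allOnes Unit F) (allOnes Unit F)
      (allOnes Unit F) (-allOnes Unit F))
    (fromBlocks (allOnes F Unit) (allOnes F Unit)
      (allOnes F Unit) (-allOnes F Unit))
    (fromBlocks (paleyCore F + 1) (paleyCore F - 1)
      (paleyCore F - 1) (-(paleyCore F + 1)))

end Paley

/-- `H'` arises from `H` by negating some rows and some columns. -/
def IsNegationOf {ι : Type*} (H' H : Matrix ι ι ℤ) : Prop :=
  ∃ a b : ι → ℤ, (∀ i, a i = 1 ∨ a i = -1) ∧ (∀ j, b j = 1 ∨ b j = -1) ∧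
    ∀ i j, H' i j = a i * H i j * b j

/-!
Upper bound. For a Hadamard matrix of order `n = 4 (m² + m + 1)` the squares of the row sums `r`
add up to `n²`, and all row sums are congruent modulo `4` to one even number
(`four_dvd_rowSum_add`). Hence `(r - k) (r - k - 4) ≥ 0` for all of them, with either `k = 2m` or
`k = 2m - 2`. Summed over the rows, either choice bounds the excess by `n (2m + 1)` (`excess_le`),
which is the Hammer–Levingston–Seberry bound (`hlsBound_four_mul`), and equality holds as soon as
all row sums are `k` or `k + 4` (`excess_eq`). So it suffices to find a sign vector `b` for which
the entries of `P b` have these absolute values; negating rows then does the rest.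

Construction. Let `η` be the quadratic character of `F`, `χ` a quartic character with values in
`ℤ[i]`, `d` a nonsquare, and `C` the conference matrix on the projective line bordering the core
`M`. Pairs of signs at a point of the projective line are encoded by fourth roots of unity `u`; in
these terms `P` acts, up to a factor `2i`, as `u ↦ (C - i) u`. The vector `b` is given by
`u(x) = χ (x² - d)` and `u(∞) = 1`. Because `x² - d` is the norm of `x + √d` and `C` is made from
`η` of a determinant, multiplication in `F(√d)` shows that `C u = J ū` with
`J = ∑ y, χ (y² - d) = X + iY` (`one_add_sum_quadraticChar_mul`). The entries of `P b` therefore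
have the absolute values `2|X|`, `2|1 - Y|` and `2|1 + Y|` (`range_abs_paleyII_mul_colSign`).

Evaluation of `J`. The identity gives `X² + Y² = q = m² + (m + 1)²`, and `X` is even. If `q` is a
power of the prime `p`, then `p ≡ 1` modulo `4`, and `p` does not divide `J`: a ring homomorphism
`ℤ[i] → F` takes `J`, up to a nonzero factor, to the binomial coefficient `3K` over `2K`, where
`q = 4K + 1`, and Lucas' theorem shows that it is prime to `p` (`not_dvd_normCharSum`). As a power
of `p` has essentially one representation by two squares prime to `p`, it follows that
`{|X|, |Y|} = {m, m + 1}` (`normCharSum_sq_eq`), which yields the asserted row sums.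
-/

/-! ### Row sums and excess of Hadamard matrices -/

section Hadamard

variable {ι : Type*} [Fintype ι] [DecidableEq ι]

theorem Matrix.IsHadamard.entry_eq {H : Matrix ι ι ℤ} (hH : H.IsHadamard) (i j : ι) :
    H i j = 1 ∨ H i j = -1 :=
  ((isHadamard_int_iff H).1 hH).1 i j

theorem isHadamard_of_mul_transpose {H : Matrix ι ι ℤ} (hcard : Fintype.card ι ≠ 0)
    (h1 : ∀ i j, H i j = 1 ∨ H i j = -1)
    (h2 : H * Hᵀ = (Fintype.card ι : ℤ) • (1 : Matrix ι ι ℤ)) : H.IsHadamard := by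
  refine IsHadamard.of_mul_conjTranspose (fun i j => ?_) (by simpa using h2)
    (IsRegular.of_ne_zero (by exact_mod_cast hcard))
  rw [Unitary.mem_iff]
  rcases h1 i j with h | h <;> simp [h]

theorem sum_rowSum_sq {H : Matrix ι ι ℤ} (hH : H.IsHadamard) :
    ∑ i, rowSum H i ^ 2 = (Fintype.card ι : ℤ) ^ 2 := by
  have h3 := ((isHadamard_int_iff H).1 hH).2.2
  calc ∑ i, rowSum H i ^ 2 = ∑ i, ∑ j, ∑ k, H i j * H i k := by
        simp only [rowSum, sq, Finset.sum_mul_sum]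
    _ = ∑ j, ∑ k, (Hᵀ * H) j k := by
        rw [Finset.sum_comm]
        refine Finset.sum_congr rfl fun j _ => ?_
        rw [Finset.sum_comm]
        rfl
    _ = _ := by
        rw [h3]
        simp [Matrix.one_apply, sq]

/-- The row sums of a Hadamard matrix of order divisible by `4` are even, and any two of them are
congruent modulo `4`: expand `∑ k, (1 + H i k) (1 + H j k)`, each term of which is `0` or `4`. -/
theorem four_dvd_rowSum_add {H : Matrix ι ι ℤ} (hH : H.IsHadamard) (h4 : 4 ∣ Fintype.card ι)
    (i j : ι) : (4 : ℤ) ∣ rowSum H i + rowSum H j := by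
  have h4' : (4 : ℤ) ∣ Fintype.card ι := by exact_mod_cast h4
  rcases eq_or_ne i j with rfl | hij
  · have h : (2 : ℤ) ∣ ∑ k, (1 + H i k) := Finset.dvd_sum fun k _ => by
      rcases hH.entry_eq i k with h | h <;> simp [h]
    rw [Finset.sum_add_distrib] at h
    simp only [Finset.sum_const, Finset.card_univ, nsmul_eq_mul, mul_one] at h
    change (2 : ℤ) ∣ _ + rowSum H i at h
    omega
  · have h : (4 : ℤ) ∣ ∑ k, (1 + H i k) * (1 + H j k) := Finset.dvd_sum fun k _ => by
      rcases hH.entry_eq i k with h | h <;> rcases hH.entry_eq j k with h' | h' <;> simp [h, h']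
    have h0 : ∑ k, H i k * H j k = 0 := by
      have := congrFun (congrFun ((isHadamard_int_iff H).1 hH).2.1 i) j
      simpa [Matrix.mul_apply, hij] using this
    have h5 : ∑ k, (1 + H i k) * (1 + H j k)
        = Fintype.card ι + rowSum H i + rowSum H j + ∑ k, H i k * H j k := by
      simp only [rowSum, add_mul, mul_add, one_mul, mul_one, Finset.sum_add_distrib,
        Finset.sum_const, Finset.card_univ, nsmul_eq_mul]
      ring
    rw [h5, h0] at h
    omega

theorem sum_rowSum_sub_mul_sub {H : Matrix ι ι ℤ} (hH : H.IsHadamard) (k₁ k₂ : ℤ) :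
    ∑ i, (rowSum H i - k₁) * (rowSum H i - k₂)
      = (Fintype.card ι : ℤ) * (Fintype.card ι + k₁ * k₂) - (k₁ + k₂) * excess H := by
  have h1 : ∀ i, (rowSum H i - k₁) * (rowSum H i - k₂)
      = rowSum H i ^ 2 + k₁ * k₂ - (k₁ + k₂) * rowSum H i := fun i => by ring
  simp only [h1, Finset.sum_sub_distrib, Finset.sum_add_distrib, sum_rowSum_sq hH,
    ← Finset.mul_sum, Finset.sum_const, Finset.card_univ, nsmul_eq_mul]
  change _ - (k₁ + k₂) * excess H = _
  ring

/-- The product of the distances of an integer to `k` and `k + 4` is nonnegative unless the integer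
lies strictly between them, which a congruence modulo `4` forbids. -/
theorem mul_excess_le {H : Matrix ι ι ℤ} (hH : H.IsHadamard) {k : ℤ}
    (hk : ∀ i, (4 : ℤ) ∣ rowSum H i - k) :
    (2 * k + 4) * excess H ≤ (Fintype.card ι : ℤ) * (Fintype.card ι + k * (k + 4)) := by
  have h := sum_rowSum_sub_mul_sub hH k (k + 4)
  have h0 : 0 ≤ ∑ i, (rowSum H i - k) * (rowSum H i - (k + 4)) :=
    Finset.sum_nonneg fun i _ => by
      obtain ⟨c, hc⟩ := hk i
      have h1 : (rowSum H i - k) * (rowSum H i - (k + 4)) = 16 * (c * (c - 1)) := by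
        rw [show rowSum H i = 4 * c + k by omega]; ring
      rw [h1]
      -- No integer lies strictly between `0` and `1`.
      rcases le_or_gt c 0 with h2 | h2
      · nlinarith
      · nlinarith
  linarith

/-- All row sums are congruent modulo `4` either to `2 * m` or to `2 * m - 2`, and the two cases
lead to the same bound. -/
theorem excess_le {m : ℕ} (hm : 0 < m) (hcard : Fintype.card ι = 4 * (m ^ 2 + m + 1))
    {H : Matrix ι ι ℤ} (hH : H.IsHadamard) :
    excess H ≤ 4 * ((m : ℤ) ^ 2 + m + 1) * (2 * m + 1) := by
  have h4 := four_dvd_rowSum_add hH ⟨_, hcard⟩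
  have hc : (Fintype.card ι : ℤ) = 4 * ((m : ℤ) ^ 2 + m + 1) := by exact_mod_cast hcard
  have hm' : (0 : ℤ) < m := by exact_mod_cast hm
  have : Nonempty ι := Fintype.card_pos_iff.1 (by omega)
  obtain ⟨i₀⟩ := ‹Nonempty ι›
  have key : (∀ i, (4 : ℤ) ∣ rowSum H i - 2 * m) ∨ (∀ i, (4 : ℤ) ∣ rowSum H i - (2 * m - 2)) := by
    have h0 := h4 i₀ i₀
    by_cases h : (4 : ℤ) ∣ rowSum H i₀ - 2 * m
    · left; intro i; have := h4 i i₀; omega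
    · right; intro i; have := h4 i i₀; omega
  rcases key with h | h
  · have h1 := mul_excess_le hH h
    rw [hc] at h1
    refine le_of_mul_le_mul_left (a := 4 * ((m : ℤ) + 1)) ?_ (by linarith)
    linarith
  · have h1 := mul_excess_le hH h
    rw [hc] at h1
    refine le_of_mul_le_mul_left (a := 4 * (m : ℤ)) ?_ (by linarith)
    linarith

/-- Two-valued row sums turn the inequality behind `excess_le` into an equality; again both pairs
of values give the same number. -/
theorem excess_eq {m : ℕ} (hm : 0 < m) (hcard : Fintype.card ι = 4 * (m ^ 2 + m + 1))
    {H : Matrix ι ι ℤ} (hH : H.IsHadamard)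
    (h : (∀ i, rowSum H i = 2 * m - 2 ∨ rowSum H i = 2 * m + 2) ∨
      (∀ i, rowSum H i = 2 * m ∨ rowSum H i = 2 * m + 4)) :
    excess H = 4 * ((m : ℤ) ^ 2 + m + 1) * (2 * m + 1) := by
  have hc : (Fintype.card ι : ℤ) = 4 * ((m : ℤ) ^ 2 + m + 1) := by exact_mod_cast hcard
  have hm' : (0 : ℤ) < m := by exact_mod_cast hm
  rcases h with h | h
  · have h1 := sum_rowSum_sub_mul_sub hH (2 * m - 2) (2 * m + 2)
    rw [Finset.sum_eq_zero fun i _ => by rcases h i with h | h <;> simp [h], hc] at h1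
    refine mul_left_cancel₀ (a := 4 * (m : ℤ)) (by positivity) ?_
    linarith
  · have h1 := sum_rowSum_sub_mul_sub hH (2 * m) (2 * m + 4)
    rw [Finset.sum_eq_zero fun i _ => by rcases h i with h | h <;> simp [h], hc] at h1
    refine mul_left_cancel₀ (a := 4 * ((m : ℤ) + 1)) (by positivity) ?_
    linarith

theorem hlsK_four_mul {m : ℕ} (hm : 0 < m) : hlsK (4 * (m ^ 2 + m + 1)) = 2 * m := by
  have h : Nat.sqrt (4 * (m ^ 2 + m + 1)) = 2 * m + 1 := by
    symm
    rw [Nat.eq_sqrt]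
    constructor <;> nlinarith
  rw [hlsK, h, show (2 * m + 1) / 2 = m by omega]
  push_cast; ring

theorem hlsT_four_mul {m : ℕ} (hm : 0 < m) : hlsT (4 * (m ^ 2 + m + 1)) = 2 * m - 2 := by
  rw [hlsT, hlsK_four_mul hm, if_neg]
  push_cast
  rw [abs_of_nonneg (by nlinarith), abs_of_nonpos (by nlinarith)]
  nlinarith

theorem hlsBound_four_mul {m : ℕ} (hm : 0 < m) :
    hlsBound (4 * (m ^ 2 + m + 1)) = 4 * ((m : ℤ) ^ 2 + m + 1) * (2 * m + 1) := by
  have h0 : (m : ℚ) ≠ 0 := by exact_mod_cast hm.ne'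
  have h : (((4 * (m ^ 2 + m + 1) : ℕ) * ((2 * (m : ℤ) - 2 + 4) ^ 2 - (4 * (m ^ 2 + m + 1) : ℕ)) :
      ℤ) : ℚ) / ((8 * (2 * (m : ℤ) - 2) + 16 : ℤ) : ℚ) = (((m : ℤ) ^ 2 + m + 1 : ℤ) : ℚ) := by
    push_cast
    rw [div_eq_iff (by ring_nf; positivity)]
    ring
  rw [hlsBound, hlsT_four_mul hm, h, Int.floor_intCast]
  push_cast
  ring

/-- Negating the columns of a Hadamard matrix by a sign vector `b` and then each row whose sum has
become negative gives a Hadamard matrix with row sums `|H b|`. -/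
theorem exists_isNegationOf_rowSum_eq_abs {H : Matrix ι ι ℤ} (hH : H.IsHadamard) {b : ι → ℤ}
    (hb : ∀ j, b j = 1 ∨ b j = -1) :
    ∃ H' : Matrix ι ι ℤ, IsNegationOf H' H ∧ H'.IsHadamard ∧
      ∀ i, rowSum H' i = |∑ j, H i j * b j| := by
  obtain ⟨a, ha, ha'⟩ : ∃ a : ι → ℤ, (∀ i, a i = 1 ∨ a i = -1) ∧
      ∀ i, a i * ∑ j, H i j * b j = |∑ j, H i j * b j| := by
    refine ⟨fun i => if 0 ≤ ∑ j, H i j * b j then 1 else -1, fun i => ?_, fun i => ?_⟩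
    · dsimp only; split_ifs <;> simp
    · dsimp only
      split_ifs with h
      · rw [abs_of_nonneg h, one_mul]
      · rw [abs_of_neg (not_le.1 h), neg_one_mul]
  refine ⟨Matrix.of fun i j => a i * H i j * b j, ⟨a, b, ha, hb, fun i j => rfl⟩, ?_, fun i => ?_⟩
  · rcases Nat.eq_zero_or_pos (Fintype.card ι) with h0 | h0
    · have := Fintype.card_eq_zero_iff.1 h0
      rwa [Subsingleton.elim (Matrix.of fun i j => a i * H i j * b j) H]
    refine isHadamard_of_mul_transpose h0.ne' (fun i j => ?_) ?_
    · rcases ha i with h1 | h1 <;> rcases hH.entry_eq i j with h2 | h2 <;>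
        rcases hb j with h3 | h3 <;> simp [h1, h2, h3]
    · ext i j
      have h := congrFun (congrFun ((isHadamard_int_iff H).1 hH).2.1 i) j
      rw [Matrix.mul_apply] at h ⊢
      simp only [transpose_apply, of_apply] at h ⊢
      have h1 : ∀ k, a i * H i k * b k * (a j * H j k * b k) = a i * a j * (H i k * H j k) := by
        intro k
        rcases hb k with h3 | h3 <;> rw [h3] <;> ring
      simp only [h1, ← Finset.mul_sum, h]
      rcases eq_or_ne i j with rfl | hij
      · rcases ha i with h1 | h1 <;> simp [h1]
      · simp [hij]
  · rw [← ha', rowSum, Finset.mul_sum]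
    exact Finset.sum_congr rfl fun j _ => by simp [mul_assoc]

end Hadamard

/-! ### The Paley type-II matrix is Hadamard -/

section PaleyHadamard

variable {F : Type*} [Field F] [Fintype F] [DecidableEq F]

theorem quadraticChar_neg_of_card_mod_four (hF : Fintype.card F % 4 = 1) (a : F) :
    quadraticChar F (-a) = quadraticChar F a := by
  have hsq : IsSquare (-1 : F) := FiniteField.isSquare_neg_one_iff.2 (by omega)
  rw [neg_eq_neg_one_mul, map_mul, (quadraticChar_one_iff_isSquare (by simp)).2 hsq, one_mul]

theorem ringChar_ne_two_of_card_mod_four {F : Type*} [Field F] [Fintype F]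
    (hF : Fintype.card F % 4 = 1) : ringChar F ≠ 2 := by
  rw [Ne, FiniteField.even_card_iff_char_two]
  omega

theorem sum_quadraticChar_sub (hF : ringChar F ≠ 2) (a : F) :
    ∑ x, quadraticChar F (x - a) = 0 := by
  rw [← quadraticChar_sum_zero hF]
  exact Fintype.sum_equiv (Equiv.subRight a) _ _ fun _ => rfl

/-- Off the diagonal this is the Jacobi sum of the quadratic character with itself. -/
theorem sum_quadraticChar_sub_mul (hF : Fintype.card F % 4 = 1) (a b : F) :
    ∑ x, quadraticChar F (x - a) * quadraticChar F (x - b)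
      = if a = b then (Fintype.card F : ℤ) - 1 else -1 := by
  have hF2 := ringChar_ne_two_of_card_mod_four hF
  split_ifs with hab
  · subst hab
    have h : ∀ x, quadraticChar F (x - a) * quadraticChar F (x - a)
        = 1 - if x = a then 1 else 0 := by
      intro x
      rw [← sq]
      split_ifs with hx
      · simp [hx]
      · rw [quadraticChar_sq_one (sub_ne_zero.2 hx), sub_zero]
    simp only [h]
    simp
  · have hba : b - a ≠ 0 := sub_ne_zero.2 (Ne.symm hab)
    have h := jacobiSum_nontrivial_inv (quadraticChar_ne_one hF2)
    rw [(quadraticChar_isQuadratic F).inv, quadraticChar_neg_of_card_mod_four hF, map_one] at h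
    rw [← h, jacobiSum]
    symm
    refine Fintype.sum_equiv ((Equiv.mulLeft₀ (b - a) hba).trans (Equiv.addRight a)) _ _ fun x => ?_
    have h1 : (b - a) * x + a - b = -((b - a) * (1 - x)) := by ring
    simp only [Equiv.trans_apply, Equiv.mulLeft₀_apply, Equiv.coe_addRight, add_sub_cancel_right]
    rw [h1, quadraticChar_neg_of_card_mod_four hF, map_mul, map_mul]
    have h2 := quadraticChar_sq_one hba
    linear_combination (-(quadraticChar F x * quadraticChar F (1 - x))) * h2

theorem paleyCore_transpose (hF : Fintype.card F % 4 = 1) : (paleyCore F)ᵀ = paleyCore F := by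
  ext i j
  rw [transpose_apply, paleyCore, of_apply, of_apply, ← quadraticChar_neg_of_card_mod_four hF,
    neg_sub]

theorem paleyCore_mul_self (hF : Fintype.card F % 4 = 1) :
    paleyCore F * paleyCore F = (Fintype.card F : ℤ) • (1 : Matrix F F ℤ) - allOnes F F := by
  ext i j
  rw [← congrArg (paleyCore F * ·) (paleyCore_transpose hF)]
  simp only [mul_apply, transpose_apply, paleyCore, of_apply, sum_quadraticChar_sub_mul hF,
    allOnes, Matrix.sub_apply, Matrix.smul_apply, one_apply]
  split_ifs <;> simp

theorem paleyCore_mul_allOnes (hF : Fintype.card F % 4 = 1) :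
    paleyCore F * allOnes F Unit = 0 := by
  ext i j
  simpa only [mul_apply, paleyCore, allOnes, of_apply, mul_one, Matrix.zero_apply] using
    sum_quadraticChar_sub (ringChar_ne_two_of_card_mod_four hF) i

theorem allOnes_mul_paleyCore (hF : Fintype.card F % 4 = 1) :
    allOnes Unit F * paleyCore F = 0 := by
  rw [← transpose_inj, transpose_mul, paleyCore_transpose hF]
  exact paleyCore_mul_allOnes hF

theorem allOnes_transpose (α β : Type*) : (allOnes α β)ᵀ = allOnes β α := rfl

theorem allOnes_mul_allOnes_unit (F : Type*) : allOnes F Unit * allOnes Unit F = allOnes F F := by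
  ext; simp [allOnes, mul_apply]

theorem allOnes_unit_mul_allOnes (F : Type*) [Fintype F] :
    allOnes Unit F * allOnes F Unit = (Fintype.card F : ℤ) • (1 : Matrix Unit Unit ℤ) := by
  ext; simp [allOnes, mul_apply]

theorem paleyII_apply_eq (i j) : paleyII F i j = 1 ∨ paleyII F i j = -1 := by
  have h : ∀ x y : F, x ≠ y → quadraticChar F (y - x) = 1 ∨ quadraticChar F (y - x) = -1 :=
    fun x y hxy => quadraticChar_dichotomy (sub_ne_zero.2 hxy.symm)
  rcases i with (i | i) | (i | i) <;> rcases j with (j | j) | (j | j) <;>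
    simp only [paleyII, fromBlocks_apply₁₁, fromBlocks_apply₁₂, fromBlocks_apply₂₁,
      fromBlocks_apply₂₂, allOnes, Matrix.neg_apply, of_apply, Matrix.add_apply,
      Matrix.sub_apply, paleyCore, one_apply] <;>
    try simp [-quadraticChar_apply]
  all_goals
    rcases eq_or_ne i j with rfl | hij
    · simp
    · rcases h i j hij with h1 | h1 <;> simp [-quadraticChar_apply, h1, hij]

theorem card_paleyII (F : Type*) [Fintype F] :
    Fintype.card ((Unit ⊕ Unit) ⊕ (F ⊕ F)) = 2 * Fintype.card F + 2 := by
  simp only [Fintype.card_sum, Fintype.card_unit]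
  ring

theorem isHadamard_paleyII (hF : Fintype.card F % 4 = 1) : (paleyII F).IsHadamard := by
  refine isHadamard_of_mul_transpose (by rw [card_paleyII]; omega) paleyII_apply_eq ?_
  have h1 := paleyCore_mul_self hF
  have h2 := paleyCore_mul_allOnes hF
  have h3 := allOnes_mul_paleyCore hF
  rw [card_paleyII]
  simp only [paleyII, fromBlocks_transpose, fromBlocks_multiply, transpose_add, transpose_sub,
    transpose_neg, paleyCore_transpose hF, transpose_one, allOnes_transpose, mul_add, add_mul,
    mul_sub, sub_mul, neg_mul, mul_neg, mul_one, one_mul, h1, h2, h3, Matrix.mul_one,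
    Matrix.one_mul, Matrix.neg_mul, Matrix.mul_neg, Matrix.mul_add, Matrix.add_mul, Matrix.sub_mul,
    Matrix.mul_sub,
    allOnes_mul_allOnes_unit, allOnes_unit_mul_allOnes, fromBlocks_add]
  simp only [← fromBlocks_one, fromBlocks_smul, smul_zero]
  rw [show (0 : Matrix (Unit ⊕ Unit) (F ⊕ F) ℤ) = fromBlocks 0 0 0 0 by simp,
    show (0 : Matrix (F ⊕ F) (Unit ⊕ Unit) ℤ) = fromBlocks 0 0 0 0 by simp]
  congr 2 <;> push_cast <;> module

end PaleyHadamard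

/-! ### Sums of two squares and a binomial coefficient modulo a prime -/

section SumsOfTwoSquares

theorem sq_eq_or_sq_eq_of_dvd {q a b c d : ℤ} (hq : 0 < q) (hab : a ^ 2 + b ^ 2 = q)
    (hcd : c ^ 2 + d ^ 2 = q) (h : q ∣ a * d - b * c) :
    (a ^ 2 = c ^ 2 ∧ b ^ 2 = d ^ 2) ∨ (a ^ 2 = d ^ 2 ∧ b ^ 2 = c ^ 2) := by
  obtain ⟨k, hk⟩ := h
  have hid : (a * d - b * c) ^ 2 + (a * c + b * d) ^ 2 = q ^ 2 := by
    calc _ = (a ^ 2 + b ^ 2) * (c ^ 2 + d ^ 2) := by ring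
      _ = _ := by rw [hab, hcd, sq]
  rw [hk] at hid
  rcases eq_or_ne k 0 with rfl | hk0
  · left
    have h1 : q * (a ^ 2 - c ^ 2) = 0 := by
      calc q * (a ^ 2 - c ^ 2) = a ^ 2 * (c ^ 2 + d ^ 2) - c ^ 2 * (a ^ 2 + b ^ 2) := by
            rw [hab, hcd]; ring
        _ = (a * d - b * c) * (a * d + b * c) := by ring
        _ = 0 := by rw [hk]; ring
    have h2 : a ^ 2 - c ^ 2 = 0 := (mul_eq_zero.1 h1).resolve_left hq.ne'
    constructor <;> linarith
  · right
    have hk1 : 1 ≤ k ^ 2 := by have := sq_pos_of_ne_zero hk0; omega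
    have h0 : (a * c + b * d) ^ 2 ≤ 0 := by nlinarith [sq_nonneg q]
    have h0' : a * c + b * d = 0 := by
      have := le_antisymm h0 (sq_nonneg _)
      exact pow_eq_zero_iff (two_ne_zero) |>.1 this
    have h1 : q * (a ^ 2 - d ^ 2) = 0 := by
      calc q * (a ^ 2 - d ^ 2) = a ^ 2 * (c ^ 2 + d ^ 2) - d ^ 2 * (a ^ 2 + b ^ 2) := by
            rw [hab, hcd]; ring
        _ = (a * c + b * d) * (a * c - b * d) := by ring
        _ = 0 := by rw [h0']; ring
    have h2 : a ^ 2 - d ^ 2 = 0 := (mul_eq_zero.1 h1).resolve_left hq.ne'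
    constructor <;> linarith

/-- A power of an odd prime is a sum of two squares prime to it in essentially one way. -/
theorem sq_eq_or_sq_eq_of_sq_add_sq_eq_prime_pow {p : ℕ} (hp : p.Prime) (hp2 : p ≠ 2) {k : ℕ}
    (hk : k ≠ 0) {a b c d : ℤ} (hab : a ^ 2 + b ^ 2 = (p : ℤ) ^ k)
    (hcd : c ^ 2 + d ^ 2 = (p : ℤ) ^ k) (ha : ¬ ((p : ℤ) ∣ a ∧ (p : ℤ) ∣ b))
    (hc : ¬ ((p : ℤ) ∣ c ∧ (p : ℤ) ∣ d)) :
    (a ^ 2 = c ^ 2 ∧ b ^ 2 = d ^ 2) ∨ (a ^ 2 = d ^ 2 ∧ b ^ 2 = c ^ 2) := by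
  have hpZ : Prime (p : ℤ) := Nat.prime_iff_prime_int.1 hp
  have hpow : (0 : ℤ) < (p : ℤ) ^ k := pow_pos (by exact_mod_cast hp.pos) k
  have hna : ∀ x y : ℤ, x ^ 2 + y ^ 2 = (p : ℤ) ^ k → (p : ℤ) ∣ x → (p : ℤ) ∣ y := by
    intro x y hxy hx
    have h1 : (p : ℤ) ∣ x ^ 2 + y ^ 2 := hxy ▸ dvd_pow_self _ hk
    exact hpZ.dvd_of_dvd_pow ((dvd_add_right (dvd_pow hx two_ne_zero)).1 h1)
  have hpa : ¬ (p : ℤ) ∣ a := fun h => ha ⟨h, hna a b hab h⟩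
  have hpd : ¬ (p : ℤ) ∣ d := fun h => hc ⟨hna d c (by rw [add_comm]; exact hcd) h, h⟩
  have hprod : (p : ℤ) ^ k ∣ (a * d - b * c) * (a * d + b * c) :=
    ⟨a ^ 2 - c ^ 2, by linear_combination (-c ^ 2) * hab + a ^ 2 * hcd⟩
  have hcop : ∀ x : ℤ, ¬ (p : ℤ) ∣ x → IsCoprime ((p : ℤ) ^ k) x := fun x hx =>
    ((Prime.coprime_iff_not_dvd hpZ).2 hx).pow_left
  by_cases h1 : (p : ℤ) ∣ a * d - b * c
  · have h2 : ¬ (p : ℤ) ∣ a * d + b * c := by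
      intro h2
      have h3 : (p : ℤ) ∣ 2 * (a * d) := by
        have := dvd_add h1 h2
        ring_nf at this ⊢
        exact this
      rcases hpZ.dvd_or_dvd h3 with h4 | h4
      · have h5 : p ∣ 2 := by exact_mod_cast h4
        exact hp2 ((Nat.prime_dvd_prime_iff_eq hp Nat.prime_two).1 h5)
      · exact (hpZ.dvd_or_dvd h4).elim hpa hpd
    exact sq_eq_or_sq_eq_of_dvd hpow hab hcd ((hcop _ h2).dvd_of_dvd_mul_right hprod)
  · have h2 := (hcop _ h1).dvd_of_dvd_mul_left hprod
    have := sq_eq_or_sq_eq_of_dvd (a := a) (b := -b) hpow (by rw [neg_sq]; exact hab) hcd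
      (by rwa [neg_mul, sub_neg_eq_add])
    simpa only [neg_sq] using this

/-- If `p ^ k = 4 * K + 1`, all base-`p` digits of `K` are `t = (p - 1) / 4`, so Lucas' theorem
makes `(3 * K).choose (2 * K)` a product of binomial coefficients `(3 * t).choose (2 * t)`
modulo `p`. -/
theorem not_dvd_choose_of_prime_pow {p t : ℕ} (hp : p.Prime) (ht : p = 4 * t + 1) (k : ℕ) :
    ∀ K : ℕ, p ^ k = 4 * K + 1 → ¬ p ∣ (3 * K).choose (2 * K) := by
  induction k with
  | zero =>
    intro K hK
    obtain rfl : K = 0 := by simpa using hK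
    simpa using hp.one_lt.ne'
  | succ k ih =>
    intro K hK
    obtain ⟨K', hK'⟩ : ∃ K', p ^ k = 4 * K' + 1 := by
      have h1 : p ^ k % 4 = 1 := by
        rw [Nat.pow_mod, ht]
        simp [Nat.add_mod]
      exact ⟨p ^ k / 4, by omega⟩
    have hKK : K = p * K' + t := by
      have h1 : 4 * K + 1 = (4 * K' + 1) * p := by rw [← hK, ← hK', pow_succ]
      have h2 : (4 * K' + 1) * p = 4 * (p * K') + p := by ring
      omega
    have : Fact p.Prime := ⟨hp⟩
    have hL := Choose.choose_modEq_choose_mod_mul_choose_div_nat (n := 3 * K) (k := 2 * K) (p := p)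
    have h3 : 3 * K = 3 * t + p * (3 * K') := by rw [hKK]; ring
    have h2 : 2 * K = 2 * t + p * (2 * K') := by rw [hKK]; ring
    have e1 : 3 * K % p = 3 * t := by
      rw [h3, Nat.add_mul_mod_self_left, Nat.mod_eq_of_lt (by omega)]
    have e2 : 2 * K % p = 2 * t := by
      rw [h2, Nat.add_mul_mod_self_left, Nat.mod_eq_of_lt (by omega)]
    have e3 : 3 * K / p = 3 * K' := by
      rw [h3, Nat.add_mul_div_left _ _ hp.pos, Nat.div_eq_of_lt (by omega), zero_add]
    have e4 : 2 * K / p = 2 * K' := by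
      rw [h2, Nat.add_mul_div_left _ _ hp.pos, Nat.div_eq_of_lt (by omega), zero_add]
    rw [e1, e2, e3, e4] at hL
    rw [hL.dvd_iff dvd_rfl]
    intro h
    rcases hp.dvd_mul.1 h with h | h
    · have h5 : p ∣ (3 * t).factorial := by
        rw [← Nat.choose_mul_factorial_mul_factorial (show 2 * t ≤ 3 * t by omega), mul_assoc]
        exact Dvd.dvd.mul_right h _
      have := hp.dvd_factorial.1 h5
      omega
    · exact ih K' hK' h

end SumsOfTwoSquares

/-! ### Quartic characters with Gaussian integer values -/

section QuarticCharacter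

variable {F : Type*} [Field F] [Fintype F] [DecidableEq F]

/-- A quartic character `χ` with values in the Gaussian integers, together with the reduction
`ℤ[i] → F` under which `χ` becomes a power map. -/
theorem exists_quarticChar (hF : Fintype.card F % 4 = 1) :
    ∃ (χ : MulChar F GaussianInt) (φ : GaussianInt →+* F),
      (∀ x, χ x ^ 2 = (quadraticChar F x : GaussianInt)) ∧
      ∀ x, φ (χ x) = x ^ (3 * (Fintype.card F / 4)) := by
  have hF2 := ringChar_ne_two_of_card_mod_four hF
  have hF1 : 1 < Fintype.card F := Fintype.one_lt_card
  obtain ⟨g, hg⟩ := IsCyclic.exists_generator (α := Fˣ)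
  have hpow : ∀ x : Fˣ, ∃ k : ℕ, g ^ k = x := fun x => by
    have h := hg x
    rw [← (isOfFinOrder_of_finite g).mem_powers_iff_mem_zpowers] at h
    exact h
  have hηg : quadraticChar F (g : F) = -1 := by
    rcases quadraticChar_dichotomy (F := F) (a := (g : F)) g.ne_zero with h | h
    · obtain ⟨a, ha⟩ := quadraticChar_exists_neg_one hF2
      have ha0 : a ≠ 0 := fun h => by rw [h, MulChar.map_zero] at ha; exact absurd ha (by decide)
      obtain ⟨k, hk⟩ := hpow (Units.mk0 a ha0)
      have h1 : (g : F) ^ k = a := by rw [← Units.val_pow_eq_pow_val, hk, Units.val_mk0]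
      rw [← h1, map_pow, h, one_pow] at ha
      exact absurd ha (by decide)
    · exact h
  let I : GaussianIntˣ := ⟨⟨0, 1⟩, ⟨0, -1⟩, by ext <;> simp, by ext <;> simp⟩
  have hI2 : (I : GaussianInt) ^ 2 = -1 := by ext <;> simp [I, sq]
  have hI : I ∈ rootsOfUnity (Fintype.card Fˣ) GaussianInt := by
    rw [mem_rootsOfUnity, Fintype.card_units]
    obtain ⟨K, hK⟩ : ∃ K, Fintype.card F - 1 = 2 * (2 * K) := ⟨Fintype.card F / 4, by omega⟩
    rw [hK, pow_mul, pow_mul]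
    have : I ^ 2 = -1 := Units.ext (by simpa using hI2)
    rw [this]; simp
  have hg2 : (g : F) ^ (Fintype.card F / 2) = -1 := by
    rw [← quadraticChar_eq_pow_of_char_ne_two' hF2, hηg]; simp
  -- `i` is sent to `g ^ (3 * K)` with `|F| = 4 * K + 1`, not to `g ^ K`: the other reduction
  -- would turn `χ` into the `K`-th power map, and the sum in `not_dvd_normCharSum` would vanish.
  let ι : F := (g : F) ^ (3 * (Fintype.card F / 4))
  have hι : ι * ι = ((-1 : ℤ) : F) := by
    have h : 3 * (Fintype.card F / 4) + 3 * (Fintype.card F / 4) = Fintype.card F / 2 * 3 := by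
      omega
    simp only [ι]
    rw [← pow_add, h, pow_mul, hg2]
    norm_num
  refine ⟨MulChar.ofRootOfUnity hI hg, Zsqrtd.lift ⟨ι, hι⟩, fun x => ?_, fun x => ?_⟩
  · rcases eq_or_ne x 0 with rfl | hx
    · rw [MulChar.map_zero, MulChar.map_zero]; simp
    · obtain ⟨k, hk⟩ := hpow (Units.mk0 x hx)
      have h1 : (g : F) ^ k = x := by rw [← Units.val_pow_eq_pow_val, hk, Units.val_mk0]
      rw [← h1, map_pow, map_pow, MulChar.ofRootOfUnity_spec, hηg, ← pow_mul, mul_comm, pow_mul,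
        hI2]
      simp
  · rcases eq_or_ne x 0 with rfl | hx
    · rw [MulChar.map_zero, map_zero, zero_pow (by omega)]
    · obtain ⟨k, hk⟩ := hpow (Units.mk0 x hx)
      have h1 : (g : F) ^ k = x := by rw [← Units.val_pow_eq_pow_val, hk, Units.val_mk0]
      rw [← h1, map_pow, map_pow, MulChar.ofRootOfUnity_spec]
      have h2 : Zsqrtd.lift ⟨ι, hι⟩ (I : GaussianInt) = ι := by simp [I]
      rw [h2, ← pow_mul, ← pow_mul, mul_comm]

theorem GaussianInt.eq_of_sq_eq_one_or {u : GaussianInt} (hu : u ^ 2 = 1 ∨ u ^ 2 = -1) :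
    (u.im = 0 ∧ (u.re = 1 ∨ u.re = -1)) ∨ (u.re = 0 ∧ (u.im = 1 ∨ u.im = -1)) := by
  have hre : (u ^ 2).re = u.re * u.re - u.im * u.im := by rw [sq, Zsqrtd.re_mul]; ring
  have him : (u ^ 2).im = 2 * (u.re * u.im) := by rw [sq, Zsqrtd.im_mul]; ring
  have h0 : u.re * u.im = 0 := by
    rcases hu with h | h <;> rw [h] at him <;> simp at him <;> simpa using him
  have h1 : u.re * u.re - u.im * u.im = 1 ∨ u.re * u.re - u.im * u.im = -1 := by
    rcases hu with h | h <;> rw [h] at hre <;> simp at hre <;> omega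
  rcases mul_eq_zero.1 h0 with h | h
  · right
    refine ⟨h, ?_⟩
    rw [← mul_self_eq_one_iff]
    rw [h] at h1
    rcases h1 with h1 | h1 <;> nlinarith [mul_self_nonneg u.im]
  · left
    refine ⟨h, ?_⟩
    rw [← mul_self_eq_one_iff]
    rw [h] at h1
    rcases h1 with h1 | h1 <;> nlinarith [mul_self_nonneg u.re]

theorem GaussianInt.re_sum {α : Type*} (s : Finset α) (f : α → GaussianInt) :
    (∑ i ∈ s, f i).re = ∑ i ∈ s, (f i).re :=
  map_sum (⟨⟨Zsqrtd.re, rfl⟩, fun _ _ => rfl⟩ : GaussianInt →+ ℤ) f s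

theorem GaussianInt.im_sum {α : Type*} (s : Finset α) (f : α → GaussianInt) :
    (∑ i ∈ s, f i).im = ∑ i ∈ s, (f i).im :=
  map_sum (⟨⟨Zsqrtd.im, rfl⟩, fun _ _ => rfl⟩ : GaussianInt →+ ℤ) f s

end QuarticCharacter

/-! ### The quartic character sum of the norm form -/

section TorusSum

variable {F : Type*} [Field F] [Fintype F] [DecidableEq F]

/-- A function on the plane that is constant on punctured lines through the origin is summed line
by line; the lines are represented by `(1, 0)` and the points `(y, 1)`. -/
theorem sum_prod_eq_of_homogeneous {R : Type*} [CommRing R] (f : F → F → R) (h0 : f 0 0 = 0)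
    (h : ∀ r, r ≠ 0 → ∀ a b, f (r * a) (r * b) = f a b) :
    ∑ w : F × F, f w.1 w.2 = ((Fintype.card F : R) - 1) * (f 1 0 + ∑ y, f y 1) := by
  have hcard : ((Finset.univ.erase (0 : F)).card : R) = (Fintype.card F : R) - 1 := by
    rw [Finset.card_erase_of_mem (Finset.mem_univ _), Finset.card_univ,
      Nat.cast_sub Fintype.card_pos, Nat.cast_one]
  rw [Fintype.sum_prod_type_right, ← Finset.add_sum_erase _ _ (Finset.mem_univ (0 : F)), mul_add]
  congr 1
  · rw [← Finset.add_sum_erase _ _ (Finset.mem_univ (0 : F)), h0, zero_add,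
      Finset.sum_congr rfl (g := fun _ => f 1 0), Finset.sum_const, nsmul_eq_mul, hcard]
    intro x hx
    simpa using h x (Finset.ne_of_mem_erase hx) 1 0
  · rw [Finset.sum_congr rfl (g := fun _ => ∑ y, f y 1), Finset.sum_const, nsmul_eq_mul, hcard]
    intro x hx
    have hx' := Finset.ne_of_mem_erase hx
    refine (Fintype.sum_equiv (Equiv.mulLeft₀ x hx') _ _ fun y => ?_).symm
    simpa using (h x hx' y 1).symm

theorem sq_sub_ne_zero {F : Type*} [Field F] {d : F} (hd : ¬ IsSquare d) (x : F) :
    x ^ 2 - d ≠ 0 := fun h =>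
  hd ⟨x, by linear_combination -h⟩

variable {χ : MulChar F GaussianInt}

theorem quarticChar_sq_eq (hχ : ∀ x, χ x ^ 2 = (quadraticChar F x : GaussianInt)) {x : F}
    (hx : x ≠ 0) : χ x ^ 2 = 1 ∨ χ x ^ 2 = -1 := by
  rw [hχ]
  rcases quadraticChar_dichotomy hx with h | h <;> simp [h, -quadraticChar_apply]

theorem quadraticChar_mul_quarticChar (hχ : ∀ x, χ x ^ 2 = (quadraticChar F x : GaussianInt))
    {x : F} (hx : x ≠ 0) : (quadraticChar F x : GaussianInt) * χ x = star (χ x) := by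
  rw [← hχ]
  rcases GaussianInt.eq_of_sq_eq_one_or (quarticChar_sq_eq hχ hx) with
    ⟨h1, h2 | h2⟩ | ⟨h1, h2 | h2⟩ <;>
    ext <;> simp [sq, h1, h2]

/-- The value at infinity of the Paley conference matrix applied to `x ↦ χ (x² - d)`. -/
def normCharSum (χ : MulChar F GaussianInt) (d : F) : GaussianInt := ∑ y, χ (y ^ 2 - d)

/-- The conference matrix carries `x ↦ χ (x² - d)` to a multiple of its conjugate. Identify `F × F`
with `F(√d)` and consider `S v = ∑ w, η (det (v, w)) χ (N w)`. Multiplication of `v` and `w` by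
`x + √d` scales `det` and `N` by `x² - d`, which relates `S (x, 1)` to `S (1, 0)`; summation along
lines through the origin turns both into the two sides of the claim. -/
theorem one_add_sum_quadraticChar_mul (hF : Fintype.card F % 4 = 1)
    (hχ : ∀ x, χ x ^ 2 = (quadraticChar F x : GaussianInt)) {d : F} (hd : ¬ IsSquare d) (x : F) :
    1 + ∑ y, (quadraticChar F (y - x) : GaussianInt) * χ (y ^ 2 - d)
      = normCharSum χ d * star (χ (x ^ 2 - d)) := by
  let f : F → F → F → F → GaussianInt := fun a b c e =>
    (quadraticChar F (a * e - b * c) : GaussianInt) * χ (c ^ 2 - d * e ^ 2)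
  have hχ2 : ∀ r : F, r ≠ 0 → χ (r ^ 2) = (quadraticChar F r : GaussianInt) := fun r _ => by
    rw [map_pow, hχ]
  have hη2 : ∀ r : F, r ≠ 0 →
      (quadraticChar F r : GaussianInt) * (quadraticChar F r : GaussianInt) = 1 := fun r hr => by
    rw [← Int.cast_mul, ← sq, quadraticChar_sq_one hr, Int.cast_one]
  have hf0 : ∀ a b, f a b 0 0 = 0 := fun a b => by
    simp only [f, mul_zero, sub_zero, MulChar.map_zero, Int.cast_zero, zero_mul]
  have hfr : ∀ a b r, r ≠ 0 → ∀ c e, f a b (r * c) (r * e) = f a b c e := by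
    intro a b r hr c e
    simp only [f]
    rw [show a * (r * e) - b * (r * c) = r * (a * e - b * c) by ring,
      show (r * c) ^ 2 - d * (r * e) ^ 2 = r ^ 2 * (c ^ 2 - d * e ^ 2) by ring, map_mul, map_mul,
      hχ2 r hr, Int.cast_mul]
    linear_combination ((quadraticChar F (a * e - b * c) : GaussianInt) * χ (c ^ 2 - d * e ^ 2))
      * hη2 r hr
  have hN := sq_sub_ne_zero hd x
  have hone : ∀ z : F, (quadraticChar F (-z)) = quadraticChar F z :=
    quadraticChar_neg_of_card_mod_four hF
  have hS1 := sum_prod_eq_of_homogeneous (f 1 0) (hf0 1 0) (hfr 1 0)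
  have hSx := sum_prod_eq_of_homogeneous (f x 1) (hf0 x 1) (hfr x 1)
  have hrel : ∑ w : F × F, f x 1 w.1 w.2
      = star (χ (x ^ 2 - d)) * ∑ w : F × F, f 1 0 w.1 w.2 := by
    -- Multiplication by `x + √d`.
    let m : F × F → F × F := fun w => (x * w.1 + d * w.2, w.1 + x * w.2)
    have hm : Function.Bijective m := by
      rw [← Finite.injective_iff_bijective]
      rintro ⟨a, b⟩ ⟨a', b'⟩ h
      simp only [m, Prod.mk.injEq] at h
      obtain ⟨h1, h2⟩ := h
      have hb : b = b' := mul_left_cancel₀ hN (by linear_combination x * h2 - h1)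
      have ha : a = a' := by rw [hb] at h2; exact add_right_cancel h2
      rw [ha, hb]
    rw [← hm.sum_comp fun w => f x 1 w.1 w.2, Finset.mul_sum]
    refine Finset.sum_congr rfl fun w _ => ?_
    simp only [f, m]
    rw [show x * (w.1 + x * w.2) - 1 * (x * w.1 + d * w.2) = (x ^ 2 - d) * w.2 by ring,
      show (x * w.1 + d * w.2) ^ 2 - d * (w.1 + x * w.2) ^ 2
        = (x ^ 2 - d) * (w.1 ^ 2 - d * w.2 ^ 2) by ring,
      show (1 : F) * w.2 - 0 * w.1 = w.2 by ring, map_mul, map_mul,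
      ← quadraticChar_mul_quarticChar hχ hN, Int.cast_mul]
    ring
  have hq : ((Fintype.card F : GaussianInt) - 1) ≠ 0 := by
    have h1 : 1 < Fintype.card F := Fintype.one_lt_card
    rw [sub_ne_zero]
    exact_mod_cast h1.ne'
  have e1 : f 1 0 1 0 + ∑ y, f 1 0 y 1 = normCharSum χ d := by
    simp only [f, normCharSum]
    rw [show (1 : F) * 0 - 0 * 1 = 0 by ring, MulChar.map_zero, Int.cast_zero, zero_mul, zero_add]
    refine Finset.sum_congr rfl fun y _ => ?_
    rw [show (1 : F) * 1 - 0 * y = 1 by ring, map_one, Int.cast_one, one_mul, one_pow, mul_one]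
  have e2 : f x 1 1 0 + ∑ y, f x 1 y 1
      = 1 + ∑ y, (quadraticChar F (y - x) : GaussianInt) * χ (y ^ 2 - d) := by
    simp only [f]
    congr 1
    · rw [show x * 0 - 1 * 1 = -(1 : F) by ring, hone, map_one,
        show (1 : F) ^ 2 - d * 0 ^ 2 = 1 by ring, map_one, Int.cast_one, one_mul]
    · refine Finset.sum_congr rfl fun y _ => ?_
      rw [show x * 1 - 1 * y = -(y - x) by ring, hone, one_pow, mul_one]
  rw [e1] at hS1
  rw [e2] at hSx
  rw [hS1, hSx] at hrel
  refine mul_left_cancel₀ hq ?_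
  rw [hrel]; ring

/-- Sum `one_add_sum_quadraticChar_mul` over `x`: on the left only the constant `1` survives, and
the right side becomes the sum times its conjugate. -/
theorem normCharSum_re_sq_add_im_sq (hF : Fintype.card F % 4 = 1)
    (hχ : ∀ x, χ x ^ 2 = (quadraticChar F x : GaussianInt)) {d : F} (hd : ¬ IsSquare d) :
    (normCharSum χ d).re ^ 2 + (normCharSum χ d).im ^ 2 = Fintype.card F := by
  have h1 : ∑ x : F, (1 + ∑ y, (quadraticChar F (y - x) : GaussianInt) * χ (y ^ 2 - d))
      = Fintype.card F := by
    rw [Finset.sum_add_distrib, Finset.sum_comm]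
    simp only [← Finset.sum_mul, ← Int.cast_sum]
    have h2 : ∀ y : F, ∑ x, quadraticChar F (y - x) = 0 := fun y => by
      rw [← sum_quadraticChar_sub (ringChar_ne_two_of_card_mod_four hF) y]
      refine Finset.sum_congr rfl fun x _ => ?_
      rw [← quadraticChar_neg_of_card_mod_four hF, neg_sub]
    simp only [h2]
    simp
  simp only [one_add_sum_quadraticChar_mul hF hχ hd, ← Finset.mul_sum, ← star_sum] at h1
  have h3 := congrArg Zsqrtd.re h1
  rw [← normCharSum, Zsqrtd.re_mul, Zsqrtd.re_star, Zsqrtd.im_star, Zsqrtd.re_natCast] at h3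
  linarith

/-- The terms for `y` and `-y` agree, and the real part of the term for `y = 0` vanishes. -/
theorem even_normCharSum_re (hF : Fintype.card F % 4 = 1)
    (hχ : ∀ x, χ x ^ 2 = (quadraticChar F x : GaussianInt)) {d : F} (hd : ¬ IsSquare d) :
    Even (normCharSum χ d).re := by
  have h0 : (χ (-d)).re = 0 := by
    have h1 : χ (-d) ^ 2 = -1 := by
      rw [hχ, quadraticChar_neg_of_card_mod_four hF, quadraticChar_neg_one_iff_not_isSquare.2 hd]
      simp
    rcases GaussianInt.eq_of_sq_eq_one_or (Or.inr h1) with ⟨h2, h3⟩ | ⟨h2, h3⟩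
    · have h4 := congrArg Zsqrtd.re h1
      rw [sq, Zsqrtd.re_mul, h2] at h4
      rcases h3 with h3 | h3 <;> rw [h3] at h4 <;> simp at h4
    · exact h2
  rw [← ZMod.intCast_eq_zero_iff_even, normCharSum, GaussianInt.re_sum, Int.cast_sum]
  refine Finset.sum_involution (fun y _ => -y) (fun y _ => ?_) (fun y _ hy hyy => hy ?_)
    (fun _ _ => Finset.mem_univ _) (fun y _ => neg_neg y)
  · rw [neg_sq]
    exact CharTwo.add_self_eq_zero _
  · have h2 : (2 : F) ≠ 0 := Ring.two_ne_zero (ringChar_ne_two_of_card_mod_four hF)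
    have hy0 : y = 0 :=
      (mul_eq_zero.1 (by linear_combination -hyy : (2 : F) * y = 0)).resolve_left h2
    rw [hy0, zero_pow two_ne_zero, zero_sub, h0, Int.cast_zero]

/-- Only the term of degree `|F| - 1` of the expanded power contributes. -/
theorem sum_sq_sub_pow {K : ℕ} (hK : Fintype.card F = 4 * K + 1) (d : F) :
    ∑ y : F, (y ^ 2 - d) ^ (3 * K) = -((-d) ^ K * ((3 * K).choose (2 * K) : F)) := by
  have hK0 : 0 < K := by
    have : 1 < Fintype.card F := Fintype.one_lt_card
    omega
  have hpow : ∀ j ∈ Finset.range (3 * K + 1), j ≠ 2 * K → ∑ y : F, y ^ (2 * j) = 0 := by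
    intro j hj hj2
    rw [Finset.mem_range] at hj
    rcases lt_or_gt_of_ne hj2 with h | h
    · exact FiniteField.sum_pow_lt_card_sub_one F _ (by omega)
    · rw [← FiniteField.sum_pow_lt_card_sub_one F (2 * j - 4 * K) (by omega)]
      refine Finset.sum_congr rfl fun y _ => ?_
      rcases eq_or_ne y 0 with rfl | hy
      · rw [zero_pow (by omega), zero_pow (by omega)]
      · rw [show 2 * j = (Fintype.card F - 1) + (2 * j - 4 * K) by omega, pow_add,
          FiniteField.pow_card_sub_one_eq_one y hy, one_mul, hK]
        congr 1
        omega
  have htop : ∑ y : F, y ^ (2 * (2 * K)) = -1 := by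
    have h : ∀ y : F, y ^ (2 * (2 * K)) = 1 - if y = 0 then 1 else 0 := fun y => by
      split_ifs with hy
      · rw [hy, zero_pow (by omega), sub_self]
      · rw [show 2 * (2 * K) = Fintype.card F - 1 by omega,
          FiniteField.pow_card_sub_one_eq_one y hy, sub_zero]
    simp [h]
  simp only [sub_eq_add_neg, add_pow, ← pow_mul]
  rw [Finset.sum_comm]
  simp only [← Finset.sum_mul]
  rw [Finset.sum_eq_single_of_mem (2 * K) (Finset.mem_range.2 (by omega)), htop,
    show 3 * K - 2 * K = K by omega]
  · ring
  · intro j hj hj2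
    rw [hpow j hj hj2, zero_mul, zero_mul]

/-- Under the reduction `φ` the sum becomes, up to a nonzero factor, a binomial coefficient that is
prime to the characteristic. -/
theorem not_dvd_normCharSum {p t k : ℕ} [CharP F p] (hp : p.Prime) (ht : p = 4 * t + 1)
    (hcard : Fintype.card F = p ^ k) {φ : GaussianInt →+* F}
    (hφ : ∀ x, φ (χ x) = x ^ (3 * (Fintype.card F / 4))) {d : F} (hd : ¬ IsSquare d) :
    ¬ ((p : ℤ) ∣ (normCharSum χ d).re ∧ (p : ℤ) ∣ (normCharSum χ d).im) := by
  rw [← Zsqrtd.intCast_dvd]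
  rintro ⟨z, hz⟩
  obtain ⟨K, hK⟩ : ∃ K, Fintype.card F = 4 * K + 1 := by
    have h1 : p ^ k % 4 = 1 := by
      rw [Nat.pow_mod, ht]
      simp [Nat.add_mod]
    exact ⟨p ^ k / 4, by omega⟩
  have h1 := congrArg φ hz
  have h2 : φ ((p : ℤ) : GaussianInt) = 0 := by
    rw [map_intCast, Int.cast_natCast, CharP.cast_eq_zero]
  rw [map_mul, h2, zero_mul, normCharSum, map_sum] at h1
  simp only [hφ] at h1
  rw [show Fintype.card F / 4 = K by omega, sum_sq_sub_pow hK, neg_eq_zero, mul_eq_zero] at h1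
  rcases h1 with h1 | h1
  · have hd0 : d = 0 := neg_eq_zero.1 (eq_zero_of_pow_eq_zero h1)
    exact hd (hd0 ▸ IsSquare.zero)
  · exact not_dvd_choose_of_prime_pow hp ht k K (hcard ▸ hK) ((CharP.cast_eq_zero_iff F p _).1 h1)

end TorusSum

/-! ### Column signs for the Paley matrix and the resulting row sums -/

section ColumnSigns

variable {F : Type*} [Field F] [Fintype F] [DecidableEq F] {χ : MulChar F GaussianInt}

/-- The column signs. A pair `(b₁, b₂)` of signs in the two columns belonging to a point of the
projective line is encoded by the fourth root of unity `u` with `b₁ - i b₂ = (1 + i) u`; here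
`u = 1` at infinity and `u = χ (x² - d)` at `x`. -/
def paleyColSign (χ : MulChar F GaussianInt) (d : F) : (Unit ⊕ Unit) ⊕ (F ⊕ F) → ℤ :=
  Sum.elim (Sum.elim (fun _ => 1) (fun _ => -1))
    (Sum.elim (fun x => (χ (x ^ 2 - d)).re - (χ (x ^ 2 - d)).im)
      (fun x => -((χ (x ^ 2 - d)).re + (χ (x ^ 2 - d)).im)))

theorem quarticChar_sq_sub_cases (hχ : ∀ x, χ x ^ 2 = (quadraticChar F x : GaussianInt)) {d : F}
    (hd : ¬ IsSquare d) (x : F) :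
    ((χ (x ^ 2 - d)).im = 0 ∧ ((χ (x ^ 2 - d)).re = 1 ∨ (χ (x ^ 2 - d)).re = -1)) ∨
      ((χ (x ^ 2 - d)).re = 0 ∧ ((χ (x ^ 2 - d)).im = 1 ∨ (χ (x ^ 2 - d)).im = -1)) :=
  GaussianInt.eq_of_sq_eq_one_or (quarticChar_sq_eq hχ (sq_sub_ne_zero hd x))

theorem paleyColSign_eq (hχ : ∀ x, χ x ^ 2 = (quadraticChar F x : GaussianInt)) {d : F}
    (hd : ¬ IsSquare d) (j) : paleyColSign χ d j = 1 ∨ paleyColSign χ d j = -1 := by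
  rcases j with (_ | _) | (x | x)
  · exact Or.inl rfl
  · exact Or.inr rfl
  all_goals
    simp only [paleyColSign, Sum.elim_inr, Sum.elim_inl]
    rcases quarticChar_sq_sub_cases hχ hd x with ⟨h1, h2 | h2⟩ | ⟨h1, h2 | h2⟩ <;> simp [h1, h2]

theorem one_add_sum_paleyCore_mul_re (hF : Fintype.card F % 4 = 1)
    (hχ : ∀ x, χ x ^ 2 = (quadraticChar F x : GaussianInt)) {d : F} (hd : ¬ IsSquare d) (x : F) :
    1 + ∑ y, paleyCore F x y * (χ (y ^ 2 - d)).re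
      = (normCharSum χ d).re * (χ (x ^ 2 - d)).re + (normCharSum χ d).im * (χ (x ^ 2 - d)).im := by
  have h := congrArg Zsqrtd.re (one_add_sum_quadraticChar_mul hF hχ hd x)
  simp only [Zsqrtd.re_add, Zsqrtd.re_one, GaussianInt.re_sum, Zsqrtd.re_mul, Zsqrtd.re_star,
    Zsqrtd.im_star, Zsqrtd.re_intCast, Zsqrtd.im_intCast, mul_zero, zero_mul, add_zero] at h
  simp only [paleyCore, of_apply]
  linarith

theorem sum_paleyCore_mul_im (hF : Fintype.card F % 4 = 1)
    (hχ : ∀ x, χ x ^ 2 = (quadraticChar F x : GaussianInt)) {d : F} (hd : ¬ IsSquare d) (x : F) :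
    ∑ y, paleyCore F x y * (χ (y ^ 2 - d)).im
      = (normCharSum χ d).im * (χ (x ^ 2 - d)).re - (normCharSum χ d).re * (χ (x ^ 2 - d)).im := by
  have h := congrArg Zsqrtd.im (one_add_sum_quadraticChar_mul hF hχ hd x)
  simp only [Zsqrtd.im_add, Zsqrtd.im_one, GaussianInt.im_sum, Zsqrtd.im_mul, Zsqrtd.re_star,
    Zsqrtd.im_star, Zsqrtd.re_intCast, Zsqrtd.im_intCast, zero_mul, add_zero, zero_add] at h
  simp only [paleyCore, of_apply]
  linarith

theorem paleyII_mul_colSign_infty₁ (χ : MulChar F GaussianInt) (d : F) (u : Unit) :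
    ∑ j, paleyII F (Sum.inl (Sum.inl u)) j * paleyColSign χ d j
      = 2 * (1 - (normCharSum χ d).im) := by
  simp only [Fintype.sum_sum_type, paleyII, fromBlocks_apply₁₁, fromBlocks_apply₁₂, allOnes,
    of_apply, paleyColSign, Sum.elim_inl, Sum.elim_inr, one_mul, Finset.sum_neg_distrib,
    Finset.sum_sub_distrib, Finset.sum_add_distrib, normCharSum, GaussianInt.im_sum]
  simp
  ring

theorem paleyII_mul_colSign_infty₂ (χ : MulChar F GaussianInt) (d : F) (u : Unit) :
    ∑ j, paleyII F (Sum.inl (Sum.inr u)) j * paleyColSign χ d j = 2 * (normCharSum χ d).re := by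
  simp only [Fintype.sum_sum_type, paleyII, fromBlocks_apply₁₁, fromBlocks_apply₁₂,
    fromBlocks_apply₂₁, fromBlocks_apply₂₂, allOnes, Matrix.neg_apply,
    of_apply, paleyColSign, Sum.elim_inl, Sum.elim_inr, one_mul, neg_mul, Finset.sum_neg_distrib,
    Finset.sum_sub_distrib, Finset.sum_add_distrib, normCharSum, GaussianInt.re_sum]
  simp
  ring

theorem paleyII_mul_colSign_left (hF : Fintype.card F % 4 = 1)
    (hχ : ∀ x, χ x ^ 2 = (quadraticChar F x : GaussianInt)) {d : F} (hd : ¬ IsSquare d) (x : F) :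
    ∑ j, paleyII F (Sum.inr (Sum.inl x)) j * paleyColSign χ d j
      = 2 * ((1 - (normCharSum χ d).im) * (χ (x ^ 2 - d)).re
        + (normCharSum χ d).re * (χ (x ^ 2 - d)).im) := by
  have h := sum_paleyCore_mul_im hF hχ hd x
  simp only [Fintype.sum_sum_type, paleyII, fromBlocks_apply₁₁, fromBlocks_apply₁₂,
    fromBlocks_apply₂₁, fromBlocks_apply₂₂, allOnes, Matrix.add_apply, Matrix.sub_apply, one_apply,
    of_apply, paleyColSign, Sum.elim_inl, Sum.elim_inr, one_mul, mul_neg, mul_sub, mul_add,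
    add_mul, sub_mul, Finset.sum_neg_distrib, ite_mul, zero_mul, Finset.sum_ite_eq,
    Finset.mem_univ, if_true, Finset.sum_sub_distrib, Finset.sum_add_distrib, h]
  simp
  ring

theorem paleyII_mul_colSign_right (hF : Fintype.card F % 4 = 1)
    (hχ : ∀ x, χ x ^ 2 = (quadraticChar F x : GaussianInt)) {d : F} (hd : ¬ IsSquare d) (x : F) :
    ∑ j, paleyII F (Sum.inr (Sum.inr x)) j * paleyColSign χ d j
      = 2 * ((normCharSum χ d).re * (χ (x ^ 2 - d)).re
        + (1 + (normCharSum χ d).im) * (χ (x ^ 2 - d)).im) := by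
  have h := one_add_sum_paleyCore_mul_re hF hχ hd x
  rw [← eq_sub_iff_add_eq'] at h
  simp only [Fintype.sum_sum_type, paleyII, fromBlocks_apply₂₁, fromBlocks_apply₂₂, allOnes,
    Matrix.neg_apply, Matrix.add_apply, Matrix.sub_apply, one_apply,
    of_apply, paleyColSign, Sum.elim_inl, Sum.elim_inr, one_mul, mul_neg, neg_mul, mul_sub, mul_add,
    add_mul, sub_mul, Finset.sum_neg_distrib, ite_mul, zero_mul, Finset.sum_ite_eq,
    Finset.mem_univ, if_true, Finset.sum_sub_distrib, Finset.sum_add_distrib, h]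
  simp
  ring

/-- The absolute row sums after the column negations. With `X + iY = normCharSum χ d`, the two rows
of a point `x` contribute `2 |X|` and either `2 |1 - Y|` or `2 |1 + Y|`, according to whether
`x² - d` is a square or not; both cases occur, at infinity and at `0`. -/
theorem range_abs_paleyII_mul_colSign (hF : Fintype.card F % 4 = 1)
    (hχ : ∀ x, χ x ^ 2 = (quadraticChar F x : GaussianInt)) {d : F} (hd : ¬ IsSquare d) :
    Set.range (fun i => |∑ j, paleyII F i j * paleyColSign χ d j|)
      = {2 * |(normCharSum χ d).re|, 2 * |1 - (normCharSum χ d).im|,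
          2 * |1 + (normCharSum χ d).im|} := by
  have h2 : ∀ z : ℤ, |2 * z| = 2 * |z| := fun z => by rw [abs_mul, abs_two]
  apply Set.Subset.antisymm
  · rintro _ ⟨i, rfl⟩
    rcases i with (i | i) | (x | x)
    · simp only [paleyII_mul_colSign_infty₁, h2]; simp
    · simp only [paleyII_mul_colSign_infty₂, h2]; simp
    · simp only [paleyII_mul_colSign_left hF hχ hd, h2]
      rcases quarticChar_sq_sub_cases hχ hd x with ⟨h1, h2 | h2⟩ | ⟨h1, h2 | h2⟩ <;>
        rw [h1, h2] <;> simp [-neg_sub, abs_neg]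
    · simp only [paleyII_mul_colSign_right hF hχ hd, h2]
      rcases quarticChar_sq_sub_cases hχ hd x with ⟨h1, h2 | h2⟩ | ⟨h1, h2 | h2⟩ <;>
        rw [h1, h2] <;> simp [-neg_add_rev, abs_neg]
  · rintro z (rfl | rfl | rfl)
    · exact ⟨Sum.inl (Sum.inr ()), by simp only [paleyII_mul_colSign_infty₂, h2]⟩
    · exact ⟨Sum.inl (Sum.inl ()), by simp only [paleyII_mul_colSign_infty₁, h2]⟩
    · refine ⟨Sum.inr (Sum.inr 0), ?_⟩
      have h1 : χ (0 ^ 2 - d) ^ 2 = -1 := by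
        rw [hχ, zero_pow two_ne_zero, zero_sub, quadraticChar_neg_of_card_mod_four hF,
          quadraticChar_neg_one_iff_not_isSquare.2 hd]
        simp
      simp only [paleyII_mul_colSign_right hF hχ hd, h2]
      rcases quarticChar_sq_sub_cases hχ hd 0 with ⟨h3, h4 | h4⟩ | ⟨h3, h4 | h4⟩
      · have := congrArg Zsqrtd.re h1
        rw [sq, Zsqrtd.re_mul, h3, h4] at this
        simp at this
      · have := congrArg Zsqrtd.re h1
        rw [sq, Zsqrtd.re_mul, h3, h4] at this
        simp at this
      · rw [h3, h4]; simp
      · rw [h3, h4, mul_zero, zero_add, mul_neg_one, abs_neg]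

end ColumnSigns

/-! ### Matrices of maximal excess -/

section MaximalExcess

/-- With `X + iY = normCharSum χ d`, the number `X` is even, so the parity of `m` decides
which of `|X|` and `|Y|` is `m` and which `m + 1`. -/
theorem normCharSum_sq_eq {F : Type*} [Field F] [Fintype F] [DecidableEq F] {m : ℕ}
    (hcard : Fintype.card F = 2 * m ^ 2 + 2 * m + 1) {χ : MulChar F GaussianInt}
    {φ : GaussianInt →+* F} (hχ : ∀ x, χ x ^ 2 = (quadraticChar F x : GaussianInt))
    (hφ : ∀ x, φ (χ x) = x ^ (3 * (Fintype.card F / 4))) {d : F} (hd : ¬ IsSquare d)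
    (hF : Fintype.card F % 4 = 1) :
    (Odd m → |(normCharSum χ d).re| = m + 1 ∧ |(normCharSum χ d).im| = m) ∧
      (Even m → |(normCharSum χ d).re| = m ∧ |(normCharSum χ d).im| = m + 1) := by
  obtain ⟨p, hchar, k, hp, hpk⟩ := FiniteField.card' F
  have hsum : Fintype.card F = m ^ 2 + (m + 1) ^ 2 := by rw [hcard]; ring
  have hpdvd : p ∣ Fintype.card F := hpk ▸ dvd_pow_self p k.ne_zero
  have hcop : ∀ r : ℕ, r.Prime → ¬ ((r : ℤ) ∣ (m : ℤ) ∧ (r : ℤ) ∣ (m : ℤ) + 1) := by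
    rintro r hr ⟨h1, h2⟩
    have h3 : (r : ℤ) ∣ 1 := (dvd_add_right h1).1 h2
    exact hr.one_lt.ne' (by exact_mod_cast Int.eq_one_of_dvd_one (by positivity) h3)
  have hp2 : p ≠ 2 := by
    rintro rfl
    omega
  have hp4 : p % 4 = 1 := by
    have h1 : IsSquare (-1 : ZMod (Fintype.card F)) :=
      ZMod.isSquare_neg_one_of_eq_sq_add_sq_of_coprime hsum (by simp)
    have h2 := Nat.mod_four_ne_three_of_mem_primeFactors_of_isSquare_neg_one
      (Nat.mem_primeFactors.2 ⟨hp, hpdvd, Fintype.card_ne_zero⟩) h1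
    have h3 := hp.eq_two_or_odd.resolve_left hp2
    omega
  have hXY := normCharSum_re_sq_add_im_sq hF hχ hd
  have heven := even_normCharSum_re hF hχ hd
  have hmk : (m : ℤ) ^ 2 + ((m : ℤ) + 1) ^ 2 = (p : ℤ) ^ (k : ℕ) := by
    exact_mod_cast hsum.symm.trans hpk
  rw [hpk, Nat.cast_pow] at hXY
  have huniq := sq_eq_or_sq_eq_of_sq_add_sq_eq_prime_pow hp hp2 k.ne_zero hXY hmk
    (not_dvd_normCharSum hp (t := p / 4) (by omega) hpk hφ hd) (hcop p hp)
  have habs : ∀ z : ℤ, ∀ r : ℕ, z ^ 2 = (r : ℤ) ^ 2 → |z| = r := fun z r h => by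
    rw [← Nat.abs_cast r]; exact sq_eq_sq_iff_abs_eq_abs _ _ |>.1 h
  have hcase : (|(normCharSum χ d).re| = m ∧ |(normCharSum χ d).im| = (m + 1 : ℕ)) ∨
      (|(normCharSum χ d).re| = (m + 1 : ℕ) ∧ |(normCharSum χ d).im| = m) := by
    rcases huniq with ⟨h1, h2⟩ | ⟨h1, h2⟩
    · exact Or.inl ⟨habs _ _ h1, habs _ _ (by exact_mod_cast h2)⟩
    · exact Or.inr ⟨habs _ _ (by exact_mod_cast h1), habs _ _ h2⟩
  have heven' : Even |(normCharSum χ d).re| := even_abs.2 heven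
  push_cast at hcase
  refine ⟨fun hm => hcase.resolve_left fun h => ?_, fun hm => hcase.resolve_right fun h => ?_⟩
  · rw [h.1, Int.even_coe_nat] at heven'
    exact Nat.not_even_iff_odd.2 hm heven'
  · have h1 : Even (m + 1) := by rw [h.1] at heven'; exact_mod_cast heven'
    exact (Nat.not_even_iff_odd.2 hm.add_one) h1

/-- If the row sums take the two values belonging to the parity of `m`, then the excess is the
largest possible one and attains the Hammer–Levingston–Seberry bound. -/
theorem maximumExcess_of_range_rowSum {ι : Type*} [Fintype ι] [DecidableEq ι] {m : ℕ} (hm : 0 < m)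
    (hcard : Fintype.card ι = 4 * (m ^ 2 + m + 1)) {H : Matrix ι ι ℤ} (hH : H.IsHadamard)
    (hodd : Odd m → Set.range (rowSum H) = {2 * (m : ℤ) - 2, 2 * (m : ℤ) + 2})
    (heven : Even m → Set.range (rowSum H) = {2 * (m : ℤ), 2 * (m : ℤ) + 4}) :
    IsBiregularHadamard H ∧ HasMaximumExcess H ∧
      excess H = hlsBound (4 * (m ^ 2 + m + 1)) := by
  have hmem : ∀ i, rowSum H i ∈ Set.range (rowSum H) := fun i => ⟨i, rfl⟩
  have hex : excess H = 4 * ((m : ℤ) ^ 2 + m + 1) * (2 * m + 1) := by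
    refine excess_eq hm hcard hH ?_
    rcases Nat.even_or_odd m with h | h
    · right; intro i; simpa [heven h] using hmem i
    · left; intro i; simpa [hodd h] using hmem i
  refine ⟨⟨hH, ?_⟩, fun K hK => hex ▸ excess_le hm hcard hK, hex.trans (hlsBound_four_mul hm).symm⟩
  rcases Nat.even_or_odd m with h | h
  · refine ⟨2 * m, 2 * m + 4, by omega, ?_⟩
    rw [heven h]; push_cast; rfl
  · refine ⟨2 * m - 2, 2 * m + 2, by omega, ?_⟩
    rw [hodd h, Nat.cast_sub (by omega)]; push_cast; rfl

/-- The case distinction on the sign of `Y = (normCharSum χ d).im` only interchanges `|1 - Y|` and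
`|1 + Y|`. -/
theorem exists_isNegationOf_paleyII {F : Type*} [Field F] [Fintype F] [DecidableEq F] {m : ℕ}
    (hcard : Fintype.card F = 2 * m ^ 2 + 2 * m + 1) :
    ∃ H' : Matrix ((Unit ⊕ Unit) ⊕ (F ⊕ F)) ((Unit ⊕ Unit) ⊕ (F ⊕ F)) ℤ,
      IsNegationOf H' (paleyII F) ∧ H'.IsHadamard ∧
      (Odd m → Set.range (rowSum H') = {2 * (m : ℤ) - 2, 2 * (m : ℤ) + 2}) ∧
      (Even m → Set.range (rowSum H') = {2 * (m : ℤ), 2 * (m : ℤ) + 4}) := by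
  have hF : Fintype.card F % 4 = 1 := by
    obtain ⟨c, hc⟩ := (Nat.even_mul_succ_self m)
    have : 2 * m ^ 2 + 2 * m + 1 = 4 * c + 1 := by
      linarith [hc, show m * (m + 1) = m ^ 2 + m by ring]
    omega
  obtain ⟨χ, φ, hχ, hφ⟩ := exists_quarticChar hF
  obtain ⟨d, hd⟩ := FiniteField.exists_nonsquare (ringChar_ne_two_of_card_mod_four hF)
  obtain ⟨H', hneg, hH', hrow⟩ :=
    exists_isNegationOf_rowSum_eq_abs (isHadamard_paleyII hF) (paleyColSign_eq hχ hd)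
  obtain ⟨hodd, heven⟩ := normCharSum_sq_eq hcard hχ hφ hd hF
  have hrange := range_abs_paleyII_mul_colSign hF hχ hd
  rw [← funext hrow] at hrange
  refine ⟨H', hneg, hH', fun hm => ?_, fun hm => ?_⟩
  · obtain ⟨hX, hY⟩ := hodd hm
    rw [hrange, hX]
    have hm0 := hm.pos
    rcases (abs_eq (by positivity)).1 hY with h | h <;> rw [h]
    · rw [abs_of_nonpos (by omega), abs_of_nonneg (by omega)]
      ext z; simp only [Set.mem_insert_iff, Set.mem_singleton_iff]; omega
    · rw [abs_of_nonneg (by omega), abs_of_nonpos (by omega)]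
      ext z; simp only [Set.mem_insert_iff, Set.mem_singleton_iff]; omega
  · obtain ⟨hX, hY⟩ := heven hm
    rw [hrange, hX]
    rcases (abs_eq (by positivity)).1 hY with h | h <;> rw [h]
    · rw [abs_of_nonpos (by omega), abs_of_nonneg (by omega)]
      ext z; simp only [Set.mem_insert_iff, Set.mem_singleton_iff]; omega
    · rw [abs_of_nonneg (by omega), abs_of_nonpos (by omega)]
      ext z; simp only [Set.mem_insert_iff, Set.mem_singleton_iff]; omega

theorem rowSum_reindex {ι κ : Type*} [Fintype ι] [Fintype κ] (e : ι ≃ κ) (H : Matrix ι ι ℤ) :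
    rowSum (reindex e e H) = rowSum H ∘ e.symm := by
  ext i
  exact e.symm.sum_comp fun j => H (e.symm i) j

end MaximalExcess

theorem theorem1p3 (m : ℕ) (hq : IsPrimePow (2 * m ^ 2 + 2 * m + 1)) :
    (∃ H : Matrix (Fin (4 * (m ^ 2 + m + 1))) (Fin (4 * (m ^ 2 + m + 1))) ℤ,
      IsBiregularHadamard H ∧ HasMaximumExcess H ∧
      excess H = hlsBound (4 * (m ^ 2 + m + 1)) ∧
      (Odd m → Set.range (rowSum H) = {2 * (m : ℤ) - 2, 2 * (m : ℤ) + 2}) ∧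
      (Even m → Set.range (rowSum H) = {2 * (m : ℤ), 2 * (m : ℤ) + 4})) ∧
    ∀ (F : Type*) [Field F] [Fintype F] [DecidableEq F],
      Fintype.card F = 2 * m ^ 2 + 2 * m + 1 →
      ∃ H' : Matrix ((Unit ⊕ Unit) ⊕ (F ⊕ F)) ((Unit ⊕ Unit) ⊕ (F ⊕ F)) ℤ,
        IsNegationOf H' (paleyII F) ∧
        IsBiregularHadamard H' ∧ HasMaximumExcess H' ∧
        excess H' = hlsBound (4 * (m ^ 2 + m + 1)) ∧
        (Odd m → Set.range (rowSum H') = {2 * (m : ℤ) - 2, 2 * (m : ℤ) + 2}) ∧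
        (Even m → Set.range (rowSum H') = {2 * (m : ℤ), 2 * (m : ℤ) + 4}) := by
  have hm : 0 < m := by
    rcases Nat.eq_zero_or_pos m with rfl | h
    · exact absurd rfl hq.ne_one
    · exact h
  constructor
  · obtain ⟨p, k, hp, hk, hpk⟩ := hq
    have : Fact p.Prime := ⟨Nat.prime_iff.2 hp⟩
    classical
    let F := GaloisField p k
    have : Fintype F := Fintype.ofFinite F
    have hcard : Fintype.card F = 2 * m ^ 2 + 2 * m + 1 := by
      rw [← hpk, ← GaloisField.card p k hk.ne', Nat.card_eq_fintype_card]
    obtain ⟨H', -, hH', hodd, heven⟩ := exists_isNegationOf_paleyII hcard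
    have e : (Unit ⊕ Unit) ⊕ (F ⊕ F) ≃ Fin (4 * (m ^ 2 + m + 1)) :=
      Fintype.equivFinOfCardEq (by rw [card_paleyII, hcard]; ring)
    have hrange : Set.range (rowSum (reindex e e H')) = Set.range (rowSum H') := by
      rw [rowSum_reindex, e.symm.surjective.range_comp]
    have hodd' := fun h => hrange.trans (hodd h)
    have heven' := fun h => hrange.trans (heven h)
    obtain ⟨h1, h2, h3⟩ := maximumExcess_of_range_rowSum hm (Fintype.card_fin _)
      (hH'.reindex e e) hodd' heven'
    exact ⟨_, h1, h2, h3, hodd', heven'⟩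
  · intro F _ _ _ hcard
    obtain ⟨H', hneg, hH', hodd, heven⟩ := exists_isNegationOf_paleyII hcard
    obtain ⟨h1, h2, h3⟩ := maximumExcess_of_range_rowSum hm
      (by rw [card_paleyII, hcard]; ring) hH' hodd heven
    exact ⟨H', hneg, h1, h2, h3, hodd, heven⟩
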